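/- **Theorem.** Let $f:\mathbb R^n\times\mathbb R^m\to\mathbb R^n$ and $U:\mathbb R^n\times\mathbb R_{\ge 0}\to\mathbb R^m$, and put $u_c(x):=U(x,0)$. Write $|\cdot|$ for the Euclidean norm. Suppose that: (i) $f(0,0)=0$, and for all $M,M_u\ge 0$ there is $L>0$ with $|f(x,u)-f(y,v)|\le L(|x-y|+|u-v|)$ whenever $|x|,|y|\le M$ and $|u|,|v|\le M_u$; $u_c(0)=0$, and for every $M\ge0$ there is $L>0$ with $|u_c(x)-u_c(y)|\le L|x-y|$ whenever $|x|,|y|\le M$; (ii) ($U$ is StL) for each $M\ge 0$ there are $K(M)>0$ and $T^*(M)>0$, with $T^*(\cdot)$ nonincreasing, such that $U(0,T)=0$ and $|U(x,T)-U(y,T)|\le K(M)|x-y|$ for all $|x|,|y|\le M$ and $T\in[0,T^*(M))$; (iii) ($(U_c,U)$ is StC, where $U_c(x,T):=u_c(x)$) for each $M\ge0$ there are $\rho\in\mathcal K_\infty$ and $T^*>0$ such that $|u_c(x)-U(x,T)|\le\rho(T)|x|$ for all $|x|\le M$ and $T\in[0,T^*)$. Let $F^e(x,u,T)$ be the exact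 discrete-time model of $\dot x=f(x,u)$ under zero-order hold, that is, $F^e(x,u,s)=x+\int_0^s f(F^e(x,u,r),u)\,dr$ for all $s\in[0,T]$ (it is defined as long as this solution exists), and let $\bar F^e_U(x,T):=F^e(x,U(x,T),T)$. Then the continuous-time closed loop $$\dot x=f(x,u_c(x))\qquad(1)$$ satisfies: a) (1) is LES if and only if $\bar F^e_U$ is LES-VSR; b) (1) is GALES if and only if $\bar F^e_U$ is SLES-VSR; c) (1) is GES if and only if $\bar F^e_U$ is SES-VSR. Here the notions are as follows. A function $\alpha:\mathbb R_{\ge0}\to\mathbb R_{\ge0}$ is in $\mathcal K$ if it is continuous, strictly increasing and $\alpha(0)=0$, and in $\mathcal K_\infty$ if it is moreover unbounded. A function $\beta:\mathbb R_{\ge0}\times\mathbb R_{\ge0}\to\mathbb R_{\ge0}$ is in $\mathcal{KL}$ if $\beta(\cdot,t)\in\mathcal K$ for each $t\ge0$, $\beta(s,\cdot)$ is strictly decreasing for each $s>0$, and $\beta(s,t)\to0$ as $t\to\infty$ for each $s\ge 0$. System (1) is *GAS* if there is $\beta\in\mathcal{KL}$ such that for every $x_0\in\mathbb R^n$ the solution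 with $x(0)=x_0$ exists for all $t\ge0$ and $|x(t)|\le\beta(|x_0|,t)$ for all $t\ge0$; *GES* if this holds with $\beta(r,t)=Kre^{-\lambda t}$ for some $K\ge1$, $\lambda>0$; *LES* if there are $K\ge1$ and $R,\lambda>0$ such that for every $|x_0|\le R$ the solution exists for all $t\ge0$ and $|x(t)|\le K|x_0|e^{-\lambda t}$ for all $t\ge 0$; *GALES* if it is GAS and LES. For $T^*>0$ let $\Phi(T^*)$ be the set of all sequences $\{T_i\}_{i\ge0}$ with $T_i\in(0,T^*)$ for all $i$, and put $t_k:=\sum_{i=0}^{k-1}T_i$. For a discrete-time model $\bar F$ consider the solutions of $x_{k+1}=\bar F(x_k,T_k)$. The model is *SPS-VSR* if there is $\beta\in\mathcal{KL}$ such that for every $M\ge0$ and $R>0$ there is $T^*>0$ such that for all $\{T_i\}\in\Phi(T^*)$ and $|x_0|\le M$ the solution is defined for all $k\ge 0$ and $|x_k|\le\beta(|x_0|,t_k)+R$ for all $k\ge 0$; *LES-VSR* if there are $K\ge1$ and $R,T^*,\lambda>0$ such that for all $\{T_i\}\in\Phi(T^*)$ and $|x_0|\le R$ the solution is defined for all $k\ge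 0$ and $|x_k|\le K|x_0|e^{-\lambda t_k}$ for all $k\ge 0$; *SLES-VSR* if it is SPS-VSR and LES-VSR; *SES-VSR* if there are $K\ge1$ and $\lambda>0$ such that for every $M\ge0$ there is $T^*>0$ such that for all $\{T_i\}\in\Phi(T^*)$ and $|x_0|\le M$ the solution is defined for all $k\ge 0$ and $|x_k|\le K|x_0|e^{-\lambda t_k}$ for all $k\ge 0$. -/

import Mathlib

open Set Filter Topology

namespace SampledData

/-- `ℝⁿ` with the Euclidean norm. -/
abbrev E (n : ℕ) : Type := EuclideanSpace ℝ (Fin n)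

/-! ### Comparison functions (only their values on nonnegative arguments matter) -/

/-- Class `𝒦`: continuous, strictly increasing on `[0, ∞)`, and zero at zero. -/
def IsClassK (α : ℝ → ℝ) : Prop :=
  ContinuousOn α (Ici 0) ∧ StrictMonoOn α (Ici 0) ∧ α 0 = 0

/-- Class `𝒦_∞`: unbounded class `𝒦` functions. -/
def IsClassKInf (α : ℝ → ℝ) : Prop :=
  IsClassK α ∧ ∀ C : ℝ, ∃ s : ℝ, 0 ≤ s ∧ C < α s

/-- Class `𝒦ℒ`. Since `β 0 t = 0` for all `t ≥ 0`, strict decrease is asked for at `s > 0`. -/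
def IsClassKL (β : ℝ → ℝ → ℝ) : Prop :=
  (∀ t : ℝ, 0 ≤ t → IsClassK (fun s => β s t)) ∧
  (∀ s : ℝ, 0 < s → StrictAntiOn (β s) (Ici 0)) ∧
  (∀ s : ℝ, 0 ≤ s → Tendsto (β s) atTop (𝓝 0))

/-! ### Continuous-time systems -/

/-- `x` is a solution on `[0, ∞)` of `ẋ = h(x)`, `x(0) = x₀`. -/
def IsCTSolution {n : ℕ} (h : E n → E n) (x₀ : E n) (x : ℝ → E n) : Prop :=
  x 0 = x₀ ∧ ∀ t : ℝ, 0 ≤ t → HasDerivWithinAt x (h (x t)) (Ici 0) t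

/-- From `x₀` the system `ẋ = h(x)` has a solution for all `t ≥ 0`, and
`|x(t)| ≤ b(|x₀|, t)` for all `t ≥ 0`. -/
def CTBoundFrom {n : ℕ} (h : E n → E n) (b : ℝ → ℝ → ℝ) (x₀ : E n) : Prop :=
  (∃ x : ℝ → E n, IsCTSolution h x₀ x) ∧
  ∀ x : ℝ → E n, IsCTSolution h x₀ x → ∀ t : ℝ, 0 ≤ t → ‖x t‖ ≤ b ‖x₀‖ t

/-- Globally asymptotically stable. -/
def GAS {n : ℕ} (h : E n → E n) : Prop :=
  ∃ β : ℝ → ℝ → ℝ, IsClassKL β ∧ ∀ x₀ : E n, CTBoundFrom h β x₀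

/-- Globally exponentially stable. -/
def GES {n : ℕ} (h : E n → E n) : Prop :=
  ∃ K lam : ℝ, 1 ≤ K ∧ 0 < lam ∧
    ∀ x₀ : E n, CTBoundFrom h (fun r t => K * r * Real.exp (-lam * t)) x₀

/-- Locally exponentially stable. -/
def LES {n : ℕ} (h : E n → E n) : Prop :=
  ∃ K R lam : ℝ, 1 ≤ K ∧ 0 < R ∧ 0 < lam ∧
    ∀ x₀ : E n, ‖x₀‖ ≤ R → CTBoundFrom h (fun r t => K * r * Real.exp (-lam * t)) x₀

/-- Globally asymptotically and locally exponentially stable. -/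
def GALES {n : ℕ} (h : E n → E n) : Prop := GAS h ∧ LES h

/-! ### Assumptions on the plant and on the control laws -/

/-- `f(0,0) = 0` and `f` is Lipschitz on bounded sets. -/
def PlantAssumption {n m : ℕ} (f : E n → E m → E n) : Prop :=
  f 0 0 = 0 ∧ ∀ M Mu : ℝ, 0 ≤ M → 0 ≤ Mu → ∃ L : ℝ, 0 < L ∧
    ∀ (x y : E n) (u v : E m), ‖x‖ ≤ M → ‖y‖ ≤ M → ‖u‖ ≤ Mu → ‖v‖ ≤ Mu →
      ‖f x u - f y v‖ ≤ L * (‖x - y‖ + ‖u - v‖)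

/-- `u_c(0) = 0` and `u_c` is Lipschitz on bounded sets. -/
def CTControlAssumption {n m : ℕ} (uc : E n → E m) : Prop :=
  uc 0 = 0 ∧ ∀ M : ℝ, 0 ≤ M → ∃ L : ℝ, 0 < L ∧
    ∀ x y : E n, ‖x‖ ≤ M → ‖y‖ ≤ M → ‖uc x - uc y‖ ≤ L * ‖x - y‖

/-- The continuous-time control `u_c(x) := U(x,0)`. -/
def ctControl {n m : ℕ} (U : E n → ℝ → E m) : E n → E m := fun x => U x 0

/-- The pair `(U, V)` is semiglobally small-time convergent consistent. -/
def StC {n m : ℕ} (U V : E n → ℝ → E m) : Prop :=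
  ∀ M : ℝ, 0 ≤ M → ∃ (ρ : ℝ → ℝ) (Ts : ℝ), IsClassKInf ρ ∧ 0 < Ts ∧
    ∀ (x : E n) (T : ℝ), ‖x‖ ≤ M → T ∈ Ico 0 Ts → ‖U x T - V x T‖ ≤ ρ T * ‖x‖

/-- `U` is semiglobally small-time Lipschitz. -/
def StL {n m : ℕ} (U : E n → ℝ → E m) : Prop :=
  ∃ K Ts : ℝ → ℝ, (∀ M : ℝ, 0 ≤ M → 0 < K M ∧ 0 < Ts M) ∧ AntitoneOn Ts (Ici 0) ∧
    ∀ M : ℝ, 0 ≤ M → ∀ (x y : E n) (T : ℝ), ‖x‖ ≤ M → ‖y‖ ≤ M → T ∈ Ico 0 (Ts M) →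
      U 0 T = 0 ∧ ‖U x T - U y T‖ ≤ K M * ‖x - y‖

/-! ### Discrete-time models

The exact model need not be defined for all arguments (the plant may escape in finite time),
so a model `F` is given by its graph: `F x u T` is the set of values of the model at `(x, u, T)`,
empty where the model is undefined. A total function corresponds to singletons. -/

/-- The exact model `F^e` of `ẋ = f(x,u)` under zero-order hold: its value at `(x, u, T)` is `φ(T)`,
where `φ(s) = x + ∫₀ˢ f(φ(r), u) dr` for all `s ∈ [0, T]`. When `f` is locally Lipschitz there is
at most one such value. -/
def exactModel {n m : ℕ} (f : E n → E m → E n) : E n → E m → ℝ → Set (E n) :=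
  fun x u T => {y | ∃ φ : ℝ → E n, ContinuousOn φ (Icc 0 T) ∧
    (∀ s ∈ Icc 0 T, IntervalIntegrable (fun r => f (φ r) u) MeasureTheory.volume 0 s ∧
      φ s = x + ∫ r in (0 : ℝ)..s, f (φ r) u) ∧
    φ T = y}

/-- The closed-loop model `F̄_U(x,T) := F(x, U(x,T), T)`. -/
def closedLoop {n m : ℕ} (F : E n → E m → ℝ → Set (E n)) (U : E n → ℝ → E m) :
    E n → ℝ → Set (E n) :=
  fun x T => F x (U x T) T

/-- `Φ(T)`: the sequences with all terms in the open interval `(0, T)`. -/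
def Phi (Ts : ℝ) : Set (ℕ → ℝ) := {T | ∀ i, T i ∈ Ioo 0 Ts}

/-- `x` is a solution of `x_{k+1} = F̄(x_k, T_k)` from `x₀`. -/
def IsDTSolution {n : ℕ} (F : E n → ℝ → Set (E n)) (T : ℕ → ℝ) (x₀ : E n) (x : ℕ → E n) : Prop :=
  x 0 = x₀ ∧ ∀ k : ℕ, x (k + 1) ∈ F (x k) (T k)

/-- For all `{T_i} ∈ Φ(Ts)` and `|x₀| ≤ M`, the system `x_{k+1} = F̄(x_k, T_k)` has a solution for
all `k`, and `|x_k| ≤ b(|x₀|, T_0 + ⋯ + T_{k-1})` for all `k`. -/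
def DTBound {n : ℕ} (F : E n → ℝ → Set (E n)) (b : ℝ → ℝ → ℝ) (M Ts : ℝ) : Prop :=
  ∀ T ∈ Phi Ts, ∀ x₀ : E n, ‖x₀‖ ≤ M →
    (∃ x : ℕ → E n, IsDTSolution F T x₀ x) ∧
    ∀ x : ℕ → E n, IsDTSolution F T x₀ x →
      ∀ k : ℕ, ‖x k‖ ≤ b ‖x₀‖ (∑ i ∈ Finset.range k, T i)

/-- Semiglobally practically stable under varying sampling rate. -/
def SPSVSR {n : ℕ} (F : E n → ℝ → Set (E n)) : Prop :=
  ∃ β : ℝ → ℝ → ℝ, IsClassKL β ∧ ∀ M R : ℝ, 0 ≤ M → 0 < R →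
    ∃ Ts : ℝ, 0 < Ts ∧ DTBound F (fun r t => β r t + R) M Ts

/-- Locally exponentially stable under varying sampling rate. -/
def LESVSR {n : ℕ} (F : E n → ℝ → Set (E n)) : Prop :=
  ∃ K R Ts lam : ℝ, 1 ≤ K ∧ 0 < R ∧ 0 < Ts ∧ 0 < lam ∧
    DTBound F (fun r t => K * r * Real.exp (-lam * t)) R Ts

/-- Semiglobally (asymptotically) and locally exponentially stable under varying sampling rate. -/
def SLESVSR {n : ℕ} (F : E n → ℝ → Set (E n)) : Prop := SPSVSR F ∧ LESVSR F

/-- Semiglobally exponentially stable under varying sampling rate. -/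
def SESVSR {n : ℕ} (F : E n → ℝ → Set (E n)) : Prop :=
  ∃ K lam : ℝ, 1 ≤ K ∧ 0 < lam ∧ ∀ M : ℝ, 0 ≤ M →
    ∃ Ts : ℝ, 0 < Ts ∧ DTBound F (fun r t => K * r * Real.exp (-lam * t)) M Ts

end SampledData

/-! Over a fixed time horizon, the sampled closed loop is a one-step approximation of the flow of
(1). On a ball, `f` and `u_c` are replaced by globally Lipschitz extensions. During one period the
sampled trajectory then follows a field that differs from the closed-loop field by at most a small
multiple of the current state, by consistency of `U` and smallness of the period. A Gronwall
argument yields `|x_k - z(t_k)| ≤ η e^{2 L t_k} |x_0|`, with `η` arbitrarily small and one bound on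
the periods serving all period sequences (`exists_truncation`). The error is relative to `|x_0|`, so
exponential estimates survive.

From continuous time to sampling, fix a window after which the flow has contracted enough and make
the error small on it. In the exponential case the state is halved over each window and the argument
restarts (`DTBound.of_exponential`). In the asymptotic case one window leads into the region of
local exponential stability, which controls the tail (`SPSVSR.of_GAS`).

Conversely, each time `t` is reached by sampling uniformly with period `t / N`; as the admissible
period tends to zero, the sampled bounds pass to the flow (`CTBoundFrom.of_DTBound`). -/

namespace SampledData

open scoped NNReal

/-! ### Autonomous Lipschitz ODEs: uniqueness, local and global existence -/

section ODE

variable {V : Type*} [NormedAddCommGroup V] [NormedSpace ℝ V]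

/-- `φ` solves `ẋ = v(x)`, `x(0) = x` on `[0, T]`. -/
def IsSolOn (v : V → V) (x : V) (T : ℝ) (φ : ℝ → V) : Prop :=
  φ 0 = x ∧ ∀ t ∈ Icc 0 T, HasDerivWithinAt φ (v (φ t)) (Icc 0 T) t

/-- `v` is Lipschitz on bounded sets. -/
def LipschitzOnBalls (v : V → V) : Prop :=
  ∀ M : ℝ, ∃ K : ℝ≥0, LipschitzOnWith K v (Metric.closedBall 0 M)

theorem IsSolOn.continuousOn {v : V → V} {x : V} {T : ℝ} {φ : ℝ → V} (h : IsSolOn v x T φ) :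
    ContinuousOn φ (Icc 0 T) := fun t ht => (h.2 t ht).continuousWithinAt

theorem IsSolOn.hasDerivWithinAt_Ici {v : V → V} {x : V} {T : ℝ} {φ : ℝ → V}
    (h : IsSolOn v x T φ) {t : ℝ} (ht : t ∈ Ico 0 T) :
    HasDerivWithinAt φ (v (φ t)) (Ici t) t :=
  (h.2 t ⟨ht.1, ht.2.le⟩).mono_of_mem_nhdsWithin
    (mem_of_superset (Icc_mem_nhdsGE ht.2) (Icc_subset_Icc ht.1 le_rfl))

theorem IsSolOn.congr_field {v w : V → V} {x : V} {T : ℝ} {φ : ℝ → V} (h : IsSolOn v x T φ)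
    (hvw : ∀ t ∈ Icc 0 T, v (φ t) = w (φ t)) : IsSolOn w x T φ :=
  ⟨h.1, fun t ht => hvw t ht ▸ h.2 t ht⟩

/-- Both trajectories are bounded on the compact interval, so a single Lipschitz constant, that of a
ball containing them, suffices. -/
theorem IsSolOn.eqOn {v : V → V} (hv : LipschitzOnBalls v) {x : V} {T : ℝ} {φ ψ : ℝ → V}
    (h : IsSolOn v x T φ) (h' : IsSolOn v x T ψ) : EqOn φ ψ (Icc 0 T) := by
  obtain ⟨A, hA⟩ := (isCompact_Icc.image_of_continuousOn h.continuousOn).isBounded.exists_norm_le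
  obtain ⟨B, hB⟩ := (isCompact_Icc.image_of_continuousOn h'.continuousOn).isBounded.exists_norm_le
  obtain ⟨K, hK⟩ := hv (max A B)
  refine ODE_solution_unique_of_mem_Icc_right (v := fun _ => v)
    (s := fun _ => Metric.closedBall 0 (max A B)) (fun _ _ => hK) h.continuousOn
    (fun t ht => h.hasDerivWithinAt_Ici ht) ?_ h'.continuousOn
    (fun t ht => h'.hasDerivWithinAt_Ici ht) ?_ (h.1.trans h'.1.symm)
  · intro t ht
    simpa using Or.inl (hA _ (mem_image_of_mem _ ⟨ht.1, ht.2.le⟩))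
  · intro t ht
    simpa using Or.inr (hB _ (mem_image_of_mem _ ⟨ht.1, ht.2.le⟩))

/-- On the ball of radius `‖v x‖ / L` about `x` the speed is at most `2 ‖v x‖`, so the existence
time `1 / (2 L)` does not depend on `x`. This uniformity permits gluing. -/
theorem exists_isSolOn [CompleteSpace V] {v : V → V} {L : ℝ≥0} (hv : LipschitzWith L v)
    (hL : 0 < L) (x : V) {T : ℝ} (hT : 0 ≤ T) (hLT : 2 * L * T ≤ 1) :
    ∃ φ, IsSolOn v x T φ := by
  have hL' : (0 : ℝ) < L := hL
  have key : IsPicardLindelof (fun _ => v) (⟨0, left_mem_Icc.2 hT⟩ : Icc (0 : ℝ) T) x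
      (‖v x‖₊ / L) 0 (2 * ‖v x‖₊) L := by
    refine IsPicardLindelof.of_time_independent ?_ (hv.lipschitzOnWith) ?_
    · intro y hy
      have h1 : ‖v y - v x‖ ≤ L * dist y x := by
        rw [← dist_eq_norm]; exact hv.dist_le_mul y x
      have h2 : dist y x ≤ ‖v x‖ / L := by simpa using hy
      have h3 : L * dist y x ≤ ‖v x‖ := by
        rw [le_div_iff₀ hL'] at h2; linarith
      have h4 : ‖v y‖ ≤ ‖v y - v x‖ + ‖v x‖ := norm_le_norm_sub_add _ _
      push_cast
      linarith
    · push_cast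
      simp only [sub_zero, sub_self]
      rw [max_eq_left hT, le_div_iff₀ hL']
      nlinarith [norm_nonneg (v x)]
  obtain ⟨φ, h0, h⟩ := key.exists_eq_forall_mem_Icc_hasDerivWithinAt₀
  exact ⟨φ, h0, h⟩

theorem exists_global_solution [CompleteSpace V] {v : V → V} {L : ℝ≥0} (hv : LipschitzWith L v)
    (hL : 0 < L) (x₀ : V) :
    ∃ z : ℝ → V, z 0 = x₀ ∧ ∀ t : ℝ, 0 ≤ t → HasDerivWithinAt z (v (z t)) (Ici 0) t := by
  have hL' : (0 : ℝ) < L := hL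
  obtain ⟨δ, hδ, hLδ⟩ : ∃ δ : ℝ, 0 < δ ∧ 2 * L * δ ≤ 1 :=
    ⟨1 / (2 * L), by positivity, by field_simp; rfl⟩
  choose Φ hΦ using fun x => exists_isSolOn hv hL x hδ.le hLδ
  let p : ℕ → V := fun k => Nat.rec x₀ (fun _ x => Φ x δ) k
  let z : ℝ → V := fun t => Φ (p ⌊t / δ⌋₊) (t - ⌊t / δ⌋₊ * δ)
  have hz : ∀ k : ℕ, EqOn z (fun t => Φ (p k) (t - k * δ)) (Icc (k * δ) ((k + 1) * δ)) := by
    intro k t ht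
    rcases eq_or_lt_of_le ht.2 with h | h
    · have : ⌊t / δ⌋₊ = k + 1 := by
        rw [h, mul_div_assoc, div_self hδ.ne', mul_one]
        exact_mod_cast Nat.floor_natCast (k + 1)
      have e1 : ((k : ℝ) + 1) * δ - ((k + 1 : ℕ) : ℝ) * δ = 0 := by push_cast; ring
      have e2 : ((k : ℝ) + 1) * δ - k * δ = δ := by ring
      change Φ (p ⌊t / δ⌋₊) (t - ⌊t / δ⌋₊ * δ) = Φ (p k) (t - k * δ)
      rw [this, h, e1, e2, (hΦ _).1]
    · have : ⌊t / δ⌋₊ = k := by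
        rw [Nat.floor_eq_iff (div_nonneg ((by positivity : (0:ℝ) ≤ k * δ).trans ht.1) hδ.le),
          le_div_iff₀ hδ, div_lt_iff₀ hδ]
        exact ⟨ht.1, h⟩
      simp only [z, this]
  have hd : ∀ (k : ℕ) (t : ℝ), t ∈ Icc (k * δ) ((k + 1) * δ) →
      HasDerivWithinAt z (v (z t)) (Icc (k * δ) ((k + 1) * δ)) t := by
    intro k t ht
    have h1 : t - k * δ ∈ Icc 0 δ := ⟨by linarith [ht.1], by linarith [ht.2]⟩
    have h2 := (hΦ (p k)).2 _ h1
    have h3 : HasDerivWithinAt (fun t : ℝ => t - k * δ) 1 (Icc (k * δ) ((k + 1) * δ)) t :=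
      ((hasDerivAt_id t).sub_const _).hasDerivWithinAt
    have h5 : MapsTo (fun t : ℝ => t - k * δ) (Icc (k * δ) ((k + 1) * δ)) (Icc 0 δ) :=
      fun s hs => ⟨by linarith [hs.1], by linarith [hs.2]⟩
    have h4 := h2.scomp t h3 h5
    rw [one_smul] at h4
    rw [hz k ht]
    exact h4.congr (hz k) (hz k ht)
  refine ⟨z, ?_, fun t ht => ?_⟩
  · simp [z, p, (hΦ x₀).1]
  · obtain ⟨k, hk1, hk2⟩ : ∃ k : ℕ, k * δ ≤ t ∧ t < (k + 1) * δ :=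
      ⟨⌊t / δ⌋₊, by rw [← le_div_iff₀ hδ]; exact Nat.floor_le (by positivity),
        by rw [← div_lt_iff₀ hδ]; exact Nat.lt_floor_add_one _⟩
    have hR := hd k t ⟨hk1, hk2.le⟩
    rcases eq_or_lt_of_le hk1 with h | h
    · cases k with
      | zero =>
        refine hR.mono_of_mem_nhdsWithin ?_
        have : t = 0 := by simpa using h.symm
        subst this
        simpa using Icc_mem_nhdsGE hδ
      | succ k =>
        push_cast at hk1 hk2 hR h
        -- At a junction the derivatives from the two adjacent pieces are both `v (z t)`, so they
        -- combine.
        have hl := hd k t ⟨by nlinarith, h.ge⟩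
        refine ((hl.union hR).mono_of_mem_nhdsWithin ?_)
        rw [Icc_union_Icc_eq_Icc (by nlinarith) (by nlinarith)]
        exact mem_nhdsWithin_of_mem_nhds (Icc_mem_nhds (by nlinarith) hk2)
    · exact (hR.hasDerivAt (Icc_mem_nhds h hk2)).hasDerivWithinAt

end ODE

/-! ### Closed-loop solutions and the exact model as ODE solutions -/

theorem IsCTSolution.isSolOn {n : ℕ} {h : E n → E n} {x₀ : E n} {z : ℝ → E n}
    (hz : IsCTSolution h x₀ z) {s : ℝ} (hs : 0 ≤ s) (T : ℝ) :
    IsSolOn h (z s) T (fun r => z (s + r)) := by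
  refine ⟨by simp, fun t ht => ?_⟩
  have h2 := hz.2 (s + t) (by linarith [ht.1])
  have h3 : HasDerivWithinAt (fun r : ℝ => s + r) 1 (Icc 0 T) t :=
    ((hasDerivAt_id t).const_add _).hasDerivWithinAt
  have h4 := h2.scomp t h3 (fun r hr => by simp only [mem_Ici]; linarith [hr.1])
  rwa [one_smul] at h4

theorem IsCTSolution.eq {n : ℕ} {h : E n → E n} (hh : LipschitzOnBalls h) {x₀ : E n}
    {z w : ℝ → E n} (hz : IsCTSolution h x₀ z) (hw : IsCTSolution h x₀ w) {t : ℝ} (ht : 0 ≤ t) :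
    z t = w t := by
  have h1 := hz.isSolOn le_rfl t
  have h2 := hw.isSolOn le_rfl t
  rw [hz.1] at h1
  rw [hw.1] at h2
  simpa using h1.eqOn hh h2 ⟨ht, le_rfl⟩

theorem IsCTSolution.congr_field {n : ℕ} {h h' : E n → E n} {x₀ : E n} {z : ℝ → E n}
    (hz : IsCTSolution h x₀ z) (hh : ∀ t, 0 ≤ t → h (z t) = h' (z t)) : IsCTSolution h' x₀ z :=
  ⟨hz.1, fun t ht => hh t ht ▸ hz.2 t ht⟩

theorem CTBoundFrom.of_solution {n : ℕ} {h : E n → E n} (hh : LipschitzOnBalls h)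
    {b : ℝ → ℝ → ℝ} {x₀ : E n} {z : ℝ → E n} (hz : IsCTSolution h x₀ z)
    (hb : ∀ t, 0 ≤ t → ‖z t‖ ≤ b ‖x₀‖ t) : CTBoundFrom h b x₀ :=
  ⟨⟨z, hz⟩, fun _ hw t ht => (hw.eq hh hz ht) ▸ hb t ht⟩

theorem mem_exactModel_iff {n m : ℕ} {f : E n → E m → E n} {u : E m}
    (hf : Continuous fun x => f x u) {x y : E n} {T : ℝ} (hT : 0 ≤ T) :
    y ∈ exactModel f x u T ↔ ∃ φ, IsSolOn (fun x => f x u) x T φ ∧ φ T = y := by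
  constructor
  · rintro ⟨φ, hc, hφ, rfl⟩
    refine ⟨φ, ⟨by simpa using (hφ 0 ⟨le_rfl, hT⟩).2, fun t ht => ?_⟩, rfl⟩
    have := ODE.hasDerivWithinAt_picard_Icc (f := fun _ x => f x u) (u := univ) (x₀ := x)
      (left_mem_Icc.2 hT) (hf.comp continuous_snd).continuousOn hc (fun _ _ => mem_univ _) ht
    exact this.congr (fun s hs => (hφ s hs).2) (hφ t ht).2
  · rintro ⟨φ, hφ, rfl⟩
    refine ⟨φ, hφ.continuousOn, fun s hs => ⟨?_, ?_⟩, rfl⟩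
    · refine ContinuousOn.intervalIntegrable ?_
      rw [uIcc_of_le hs.1]
      exact hf.comp_continuousOn (hφ.continuousOn.mono (Icc_subset_Icc le_rfl hs.2))
    · have := ODE.picard_eq_of_hasDerivAt (f := fun _ x => f x u) (u := univ) (α := φ)
        (t₀ := 0) (t := s) (hf.comp continuous_snd).continuousOn (fun r hr => by
          rw [uIcc_of_le hs.1] at hr ⊢
          exact (hφ.2 r ⟨hr.1, hr.2.trans hs.2⟩).mono (Icc_subset_Icc le_rfl hs.2))
        (fun _ _ => mem_univ _)
      rw [← this, ODE.picard_apply, hφ.1]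

/-! ### Frozen-input fields and Gronwall estimates -/

/-- `h` is globally Lipschitz, and so are the fields `g x T` obtained by freezing the input at the
sampled state `x` with sampling period `T`; they are close to `h` near `x` when `T` is small. -/
structure IsFrozenField {n : ℕ} (h : E n → E n) (g : E n → ℝ → E n → E n) (L : ℝ≥0) : Prop where
  one_le : 1 ≤ L
  lipschitz : LipschitzWith L h
  map_zero : h 0 = 0
  lipschitz_frozen : ∀ x T, LipschitzWith L (g x T)
  near : ∀ η : ℝ, 0 < η → ∀ᶠ T in 𝓝[>] (0 : ℝ), ∀ x y,
    ‖g x T y - h y‖ ≤ L * (‖y - x‖ + η * ‖x‖)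

/-- `y` is reached from `x` in time `T` along the frozen field `g x T`. -/
def StepTo {n : ℕ} (g : E n → ℝ → E n → E n) (T : ℝ) (x y : E n) : Prop :=
  ∃ φ, IsSolOn (g x T) x T φ ∧ φ T = y

section Estimates

variable {n : ℕ} {h : E n → E n} {g : E n → ℝ → E n → E n} {L : ℝ≥0}

theorem IsFrozenField.norm_le (H : IsFrozenField h g L) (x : E n) : ‖h x‖ ≤ L * ‖x‖ := by
  have := H.lipschitz.dist_le_mul x 0
  rwa [H.map_zero, dist_zero_right, dist_zero_right] at this

/-- The deviation `d = ‖φ - x‖` grows at rate at most `2 L d + 2 L ‖x‖`; Gronwall gives `‖x‖ (e^{2 L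
s} - 1)`, and `e^r - 1 ≤ 2 r` on `[0, 1]`. -/
theorem IsFrozenField.norm_sub_le_of_isSolOn (H : IsFrozenField h g L) {T η : ℝ} (hη : η ≤ 1)
    (hLT : 2 * L * T ≤ 1) (hnear : ∀ x y, ‖g x T y - h y‖ ≤ L * (‖y - x‖ + η * ‖x‖))
    {x : E n} {φ : ℝ → E n} (hφ : IsSolOn (g x T) x T φ) {s : ℝ} (hs : s ∈ Icc 0 T) :
    ‖φ s - x‖ ≤ 4 * L * T * ‖x‖ := by
  have hL : (1 : ℝ) ≤ L := H.one_le
  have h1 := norm_le_gronwallBound_of_norm_deriv_right_le (f := fun t => φ t - x)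
    (f' := fun t => g x T (φ t)) (δ := 0) (K := 2 * L) (ε := 2 * L * ‖x‖) (a := 0) (b := T)
    (hφ.continuousOn.sub continuousOn_const)
    (fun t ht => (hφ.hasDerivWithinAt_Ici ht).sub_const _) (by simp [hφ.1])
    (fun t ht => by
      have e1 := hnear x (φ t)
      have e2 := H.norm_le (φ t)
      have e3 : ‖φ t‖ ≤ ‖φ t - x‖ + ‖x‖ := norm_le_norm_sub_add _ _
      have e4 : ‖g x T (φ t)‖ ≤ ‖g x T (φ t) - h (φ t)‖ + ‖h (φ t)‖ := norm_le_norm_sub_add _ _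
      have e5 : η * ‖x‖ ≤ ‖x‖ := mul_le_of_le_one_left (norm_nonneg _) hη
      have e6 : (L : ℝ) * ‖φ t‖ ≤ L * (‖φ t - x‖ + ‖x‖) := by gcongr
      have e7 : (L : ℝ) * (‖φ t - x‖ + η * ‖x‖) ≤ L * (‖φ t - x‖ + ‖x‖) := by gcongr
      linarith) s hs
  rw [gronwallBound_of_K_ne_0 (by positivity)] at h1
  have h2 : Real.exp (2 * L * s) - 1 ≤ 2 * (2 * L * s) := by
    have h0 : 0 ≤ 2 * L * s := by have := hs.1; positivity
    have h3 : 2 * L * s ≤ 1 := le_trans (by have := hs.2; gcongr) hLT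
    have := Real.abs_exp_sub_one_le (x := 2 * L * s) (by rwa [abs_of_nonneg h0])
    rw [abs_of_nonneg h0] at this
    exact (le_abs_self _).trans this
  have h3 : 2 * L * ‖x‖ / (2 * L) = ‖x‖ := by field_simp
  simp only [sub_zero, zero_mul, zero_add, h3] at h1
  calc ‖φ s - x‖ ≤ ‖x‖ * (Real.exp (2 * L * s) - 1) := h1
    _ ≤ ‖x‖ * (2 * (2 * L * T)) := by
        have := hs.2
        gcongr
        exact h2.trans (by gcongr)
    _ = _ := by ring

/-- Along the step, the frozen field misses `h` by at most `L (4 L T + η) ‖x‖`, by the intersample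
bound. Gronwall propagates this defect, which stays proportional to the state. -/
theorem IsFrozenField.norm_step_sub_le (H : IsFrozenField h g L) {T η : ℝ} (hT : 0 ≤ T)
    (hη : η ≤ 1) (hLT : 2 * L * T ≤ 1)
    (hnear : ∀ x y, ‖g x T y - h y‖ ≤ L * (‖y - x‖ + η * ‖x‖))
    {x y x' : E n} {ψ : ℝ → E n} (hx : StepTo g T x x') (hψ : IsSolOn h y T ψ) :
    ‖x' - ψ T‖ ≤ ‖x - y‖ * Real.exp (L * T) +
      (4 * L * T + η) * ‖x‖ * (Real.exp (L * T) - 1) := by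
  obtain ⟨φ, hφ, rfl⟩ := hx
  have hL : (1 : ℝ) ≤ L := H.one_le
  have h1 := dist_le_of_approx_trajectories_ODE (v := fun _ => h) (K := L) (f := φ) (g := ψ)
    (f' := fun t => g x T (φ t)) (g' := fun t => h (ψ t)) (a := 0) (b := T)
    (εf := L * ((4 * L * T + η) * ‖x‖)) (εg := 0) (δ := ‖x - y‖)
    (fun _ => H.lipschitz) hφ.continuousOn (fun t ht => hφ.hasDerivWithinAt_Ici ht)
    (fun t ht => by
      rw [dist_eq_norm]
      refine (hnear x (φ t)).trans ?_
      have := H.norm_sub_le_of_isSolOn hη hLT hnear hφ ⟨ht.1, ht.2.le⟩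
      gcongr
      linarith)
    hψ.continuousOn (fun t ht => hψ.hasDerivWithinAt_Ici ht) (fun t _ => by simp)
    (by rw [hφ.1, hψ.1, dist_eq_norm]) T ⟨hT, le_rfl⟩
  rw [gronwallBound_of_K_ne_0 (by positivity), dist_eq_norm] at h1
  have h3 : (L * ((4 * L * T + η) * ‖x‖) + 0) / L = (4 * L * T + η) * ‖x‖ := by
    rw [add_zero, mul_div_cancel_left₀ _ (by positivity)]
  rwa [h3, sub_zero] at h1

theorem IsFrozenField.norm_solution_le (H : IsFrozenField h g L) {x₀ : E n} {z : ℝ → E n}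
    (hz : IsCTSolution h x₀ z) {t : ℝ} (ht : 0 ≤ t) : ‖z t‖ ≤ ‖x₀‖ * Real.exp (L * t) := by
  have hs := hz.isSolOn le_rfl t
  have h1 := norm_le_gronwallBound_of_norm_deriv_right_le (δ := ‖x₀‖) (K := L) (ε := 0)
    hs.continuousOn (fun t ht => hs.hasDerivWithinAt_Ici ht) (by simp [hz.1])
    (fun s _ => by simpa using H.norm_le _) t ⟨ht, le_rfl⟩
  simpa [gronwallBound_ε0] using h1

/-- The tolerance `η` is split evenly between the intersample motion and the input mismatch. -/
theorem IsFrozenField.eventually_small (H : IsFrozenField h g L) {η : ℝ} (hη : 0 < η) :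
    ∀ᶠ T in 𝓝[>] (0 : ℝ), 0 < T ∧ 4 * L * T ≤ η / 2 ∧
      ∀ x y, ‖g x T y - h y‖ ≤ L * (‖y - x‖ + η / 2 * ‖x‖) := by
  refine eventually_mem_nhdsWithin.and (Eventually.and ?_ (H.near _ (half_pos hη)))
  have : Tendsto (fun T : ℝ => 4 * L * T) (𝓝[>] 0) (𝓝 (4 * L * 0)) :=
    ((continuous_const.mul continuous_id).tendsto 0).mono_left nhdsWithin_le_nhds
  rw [mul_zero] at this
  exact this.eventually (ge_mem_nhds (half_pos hη))

/-- A discrete Gronwall inequality for the accumulated error over many sampling periods. -/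
theorem IsFrozenField.norm_sub_solution_le (H : IsFrozenField h g L) {η : ℝ} (hη1 : η ≤ 1)
    {T : ℕ → ℝ} (hT : ∀ k, 0 < T k ∧ 4 * L * T k ≤ η / 2 ∧
      ∀ x y, ‖g x (T k) y - h y‖ ≤ L * (‖y - x‖ + η / 2 * ‖x‖))
    {x : ℕ → E n} {z : ℝ → E n} (hx : ∀ k, StepTo g (T k) (x k) (x (k + 1)))
    (hz : IsCTSolution h (x 0) z) (k : ℕ) :
    ‖x k - z (∑ i ∈ Finset.range k, T i)‖ ≤
      η * (Real.exp (2 * L * ∑ i ∈ Finset.range k, T i) -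
        Real.exp (L * ∑ i ∈ Finset.range k, T i)) * ‖x 0‖ := by
  induction k with
  | zero => simp [hz.1]
  | succ k ih =>
    have hη : 0 ≤ η := by
      have := (hT 0).2.1
      have h0 := (hT 0).1
      have : 0 ≤ 4 * L * T 0 := by positivity
      linarith
    set t := ∑ i ∈ Finset.range k, T i with ht
    have ht0 : 0 ≤ t := Finset.sum_nonneg fun i _ => (hT i).1.le
    obtain ⟨hTk, hLT, hnear⟩ := hT k
    have h1 := H.norm_step_sub_le hTk.le (by linarith) (by linarith) hnear (hx k)
      (hz.isSolOn ht0 (T k))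
    have h2 := H.norm_solution_le hz ht0
    rw [Finset.sum_range_succ, ← ht]
    have ea : Real.exp (2 * L * (t + T k)) =
        Real.exp (L * t) ^ 2 * Real.exp (L * T k) ^ 2 := by
      rw [← Real.exp_nat_mul, ← Real.exp_nat_mul, ← Real.exp_add]; push_cast; ring_nf
    have eb : Real.exp (L * (t + T k)) = Real.exp (L * t) * Real.exp (L * T k) := by
      rw [← Real.exp_add]; ring_nf
    have ec : Real.exp (2 * L * t) = Real.exp (L * t) ^ 2 := by
      rw [← Real.exp_nat_mul]; push_cast; ring_nf
    rw [ea, eb]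
    rw [ec] at ih
    have ha : 1 ≤ Real.exp (L * T k) := Real.one_le_exp (by positivity)
    have hA : 1 ≤ Real.exp (L * t) := Real.one_le_exp (by positivity)
    set a := Real.exp (L * T k)
    set A := Real.exp (L * t)
    have h3 : ‖x k‖ ≤ ‖x k - z t‖ + ‖z t‖ := norm_le_norm_sub_add _ _
    set e := ‖x k - z t‖
    set r := ‖x 0‖
    have he : 0 ≤ e := norm_nonneg _
    have hr : 0 ≤ r := norm_nonneg _
    calc ‖x (k + 1) - z (t + T k)‖ ≤ e * a + (4 * L * T k + η / 2) * ‖x k‖ * (a - 1) := h1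
      _ ≤ e * a + η * (e + r * A) * (a - 1) := by
          gcongr
          · linarith
          · linarith
      _ = e * (a + η * (a - 1)) + η * (r * A) * (a - 1) := by ring
      -- Since `η ≤ 1`, the factor is at most `2 a - 1 ≤ a ^ 2`. The profile `A ^ 2 - A` in the
      -- induction hypothesis then absorbs the new defect, with the square `(a - 1) ^ 2` to spare.
      _ ≤ e * a ^ 2 + η * (r * A) * (a - 1) := by
          gcongr
          nlinarith [mul_le_mul_of_nonneg_right hη1 (sub_nonneg.2 ha), sq_nonneg (a - 1)]
      _ ≤ (η * (A ^ 2 - A) * r) * a ^ 2 + η * (r * A) * (a - 1) := by gcongr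
      _ = η * (A ^ 2 * a ^ 2 - A * a) * r - η * r * A * (a - 1) ^ 2 := by ring
      _ ≤ η * (A ^ 2 * a ^ 2 - A * a) * r := by
          have : 0 ≤ η * r * A * (a - 1) ^ 2 := by positivity
          linarith

end Estimates

theorem exists_Phi_of_eventually {p : ℝ → Prop} (hp : ∀ᶠ T in 𝓝[>] (0 : ℝ), p T) :
    ∃ Ts : ℝ, 0 < Ts ∧ ∀ T, 0 < T → T < Ts → p T := by
  obtain ⟨Ts, h0, h⟩ := mem_nhdsGT_iff_exists_Ioo_subset.1 hp
  exact ⟨Ts, h0, fun T h1 h2 => h ⟨h1, h2⟩⟩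

/-! ### Truncation of the plant and the controller outside a ball -/

section Plant

variable {n m : ℕ} {f : E n → E m → E n} {U : E n → ℝ → E m}

theorem PlantAssumption.continuous (hf : PlantAssumption f) (u : E m) :
    Continuous fun x => f x u := by
  rw [continuous_iff_continuousAt]
  intro x
  obtain ⟨L, hL, h⟩ := hf.2 (‖x‖ + 1) ‖u‖ (by positivity) (norm_nonneg _)
  have : LipschitzOnWith ⟨L, hL.le⟩ (fun x => f x u) (Metric.closedBall 0 (‖x‖ + 1)) :=
    LipschitzOnWith.of_dist_le_mul fun a ha b hb => by
      have := h a b u u (by simpa using ha) (by simpa using hb) le_rfl le_rfl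
      rw [sub_self, norm_zero, add_zero] at this
      rw [dist_eq_norm, dist_eq_norm]
      exact this
  refine this.continuousOn.continuousAt (Metric.closedBall_mem_nhds_of_mem ?_)
  simp

theorem PlantAssumption.lipschitzOnBalls (hf : PlantAssumption f) (u : E m) :
    LipschitzOnBalls fun x => f x u := fun M => by
  obtain ⟨L, hL, h⟩ := hf.2 (max M 0) ‖u‖ (by positivity) (norm_nonneg _)
  exact ⟨⟨L, hL.le⟩, LipschitzOnWith.of_dist_le_mul fun a ha b hb => by
    have := h a b u u (le_max_of_le_left (by simpa using ha))
      (le_max_of_le_left (by simpa using hb)) le_rfl le_rfl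
    rw [sub_self, norm_zero, add_zero] at this
    rw [dist_eq_norm, dist_eq_norm]
    exact this⟩

theorem closedLoop_subsingleton (hf : PlantAssumption f) {x y y' : E n} {T : ℝ} (hT : 0 ≤ T)
    (hy : y ∈ closedLoop (exactModel f) U x T) (hy' : y' ∈ closedLoop (exactModel f) U x T) :
    y = y' := by
  obtain ⟨φ, hφ, rfl⟩ := (mem_exactModel_iff (hf.continuous _) hT).1 hy
  obtain ⟨ψ, hψ, rfl⟩ := (mem_exactModel_iff (hf.continuous _) hT).1 hy'
  exact hφ.eqOn (hf.lipschitzOnBalls _) hψ ⟨hT, le_rfl⟩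

/-- On any ball, the closed loop and its sampled version agree with globally Lipschitz ones. -/
theorem exists_isFrozenField (hf : PlantAssumption f) (huc : CTControlAssumption (ctControl U))
    (hStC : StC (fun x _ => ctControl U x) U) {M : ℝ} (hM : 0 ≤ M) :
    ∃ (h : E n → E n) (g : E n → ℝ → E n → E n) (L : ℝ≥0), IsFrozenField h g L ∧
      (∀ y, ‖y‖ ≤ M → h y = f y (ctControl U y)) ∧
      ∀ᶠ T in 𝓝[>] (0 : ℝ), ∀ x y, ‖x‖ ≤ M → ‖y‖ ≤ M → g x T y = f y (U x T) := by
  obtain ⟨Lc, hLc, huL⟩ := huc.2 M hM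
  have hk₀ : LipschitzOnWith ⟨Lc, hLc.le⟩ (ctControl U) (Metric.closedBall 0 M) :=
    LipschitzOnWith.of_dist_le_mul fun a ha b hb => by
      rw [dist_eq_norm, dist_eq_norm]
      exact huL a b (by simpa using ha) (by simpa using hb)
  obtain ⟨k, hk, hkU⟩ := hk₀.extend_finite_dimension
  generalize lipschitzExtensionConstant (E m) * ⟨Lc, hLc.le⟩ = Lk at hk
  replace hkU : ∀ x, ‖x‖ ≤ M → ctControl U x = k x := fun x hx => hkU (by simpa using hx)
  have hk0 : k 0 = 0 := by rw [← hkU 0 (by simpa using hM), huc.1]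
  have hkn : ∀ x, ‖k x‖ ≤ Lk * ‖x‖ := fun x => by
    have := hk.dist_le_mul x 0
    rwa [hk0, dist_zero_right, dist_zero_right] at this
  -- Large enough for both inputs: `‖k y‖ ≤ Lk * M`, and `U x T` differs from `k x` by at most `M`
  -- once `ρ T ≤ 1`.
  set Mu : ℝ := (Lk + 1) * M with hMu
  obtain ⟨Lf, hLf, hfL⟩ := hf.2 M Mu hM (by positivity)
  have hG₀ : LipschitzOnWith ⟨2 * Lf, by positivity⟩ (Function.uncurry f)
      (Metric.closedBall 0 M ×ˢ Metric.closedBall 0 Mu) :=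
    LipschitzOnWith.of_dist_le_mul fun a ha b hb => by
      have h1 := hfL a.1 b.1 a.2 b.2 (by simpa using ha.1) (by simpa using hb.1)
        (by simpa using ha.2) (by simpa using hb.2)
      have h2 : ‖a.1 - b.1‖ ≤ dist a b := by
        rw [← dist_eq_norm, Prod.dist_eq]; exact le_max_left _ _
      have h3 : ‖a.2 - b.2‖ ≤ dist a b := by
        rw [← dist_eq_norm, Prod.dist_eq]; exact le_max_right _ _
      rw [dist_eq_norm]
      change ‖f a.1 a.2 - f b.1 b.2‖ ≤ 2 * Lf * dist a b
      refine h1.trans ?_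
      nlinarith
  obtain ⟨G, hG, hGf⟩ := hG₀.extend_finite_dimension
  generalize lipschitzExtensionConstant (E n) * ⟨2 * Lf, _⟩ = Lg at hG
  replace hGf : ∀ x u, ‖x‖ ≤ M → ‖u‖ ≤ Mu → f x u = G (x, u) := fun x u hx hu =>
    hGf (x := (x, u)) ⟨by simpa using hx, by simpa using hu⟩
  obtain ⟨ρ, Ts, hρ, hTs, hcons⟩ := hStC M hM
  have hρ0 : ∀ η : ℝ, 0 < η → ∀ᶠ T in 𝓝[>] (0 : ℝ), T ∈ Ico 0 Ts ∧ ρ T ≤ η := fun η hη => by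
    have h1 : Tendsto ρ (𝓝[>] 0) (𝓝 (ρ 0)) :=
      (hρ.1.1 0 self_mem_Ici).mono_left (nhdsWithin_mono _ Ioi_subset_Ici_self)
    rw [hρ.1.2.2] at h1
    refine Eventually.and ?_ (h1.eventually (ge_mem_nhds hη))
    filter_upwards [Ioo_mem_nhdsGT hTs] with T hT using ⟨hT.1.le, hT.2⟩
  have hGu : ∀ y u u', ‖G (y, u) - G (y, u')‖ ≤ Lg * ‖u - u'‖ := fun y u u' => by
    simpa [dist_eq_norm, Prod.dist_eq] using hG.dist_le_mul (y, u) (y, u')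
  classical
  -- Outside the ball nothing is known about `U`, so the frozen input is `k x` there, which makes
  -- the mismatch zero. The summand `1` in the constant gives `1 ≤ L`.
  refine ⟨fun y => G (y, k y), fun x T y => G (y, if ‖x‖ ≤ M then U x T else k x),
    1 + Lg * (1 + Lk), ⟨?_, ?_, ?_, ?_, ?_⟩, ?_, ?_⟩
  · exact le_self_add
  · refine (hG.comp (LipschitzWith.id.prodMk hk)).weaken ?_
    refine le_trans ?_ le_add_self
    gcongr
    exact max_le le_self_add le_add_self
  · have h0 := hGf 0 0 (by simpa using hM) (by rw [norm_zero]; positivity)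
    rw [hk0, ← h0, hf.1]
  · intro x T
    refine (hG.comp (LipschitzWith.id.prodMk (LipschitzWith.const _))).weaken ?_
    refine le_trans ?_ le_add_self
    gcongr
    exact max_le le_self_add zero_le
  · intro η hη
    filter_upwards [hρ0 η hη] with T hT x y
    have hx : ‖(if ‖x‖ ≤ M then U x T else k x) - k x‖ ≤ η * ‖x‖ := by
      split_ifs with hxM
      · rw [norm_sub_rev, ← hkU x hxM]
        exact (hcons x T hxM hT.1).trans (by gcongr; exact hT.2)
      · simp; positivity
    have hxy : ‖k x - k y‖ ≤ Lk * ‖y - x‖ := by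
      rw [norm_sub_rev y x, ← dist_eq_norm, ← dist_eq_norm]; exact hk.dist_le_mul x y
    have h2 := hGu y (if ‖x‖ ≤ M then U x T else k x) (k y)
    have h3 := norm_sub_le_norm_sub_add_norm_sub (if ‖x‖ ≤ M then U x T else k x) (k x) (k y)
    refine h2.trans ?_
    push_cast
    have e1 : 0 ≤ ‖y - x‖ := norm_nonneg _
    have e2 : 0 ≤ η * ‖x‖ := by positivity
    have e3 : (0 : ℝ) ≤ Lg := Lg.2
    have e4 : (0 : ℝ) ≤ Lk := Lk.2
    calc (Lg : ℝ) * ‖(if ‖x‖ ≤ M then U x T else k x) - k y‖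
        ≤ Lg * (η * ‖x‖ + Lk * ‖y - x‖) := by gcongr; linarith
      _ ≤ (1 + Lg * (1 + Lk)) * (‖y - x‖ + η * ‖x‖) := by
        have : 0 ≤ Lg * ‖y - x‖ + Lg * Lk * (η * ‖x‖) := by positivity
        nlinarith
  · intro y hy
    have : ‖k y‖ ≤ Mu := (hkn y).trans (by rw [hMu]; gcongr; linarith)
    rw [hkU y hy, hGf y _ hy this]
  · filter_upwards [hρ0 1 one_pos] with T hT x y hx hy
    have h1 : ‖ctControl U x - U x T‖ ≤ 1 * ‖x‖ :=
      (hcons x T hx hT.1).trans (by gcongr; exact hT.2)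
    have h2 : ‖U x T‖ ≤ Mu := by
      have h3 : ‖U x T‖ ≤ ‖U x T - ctControl U x‖ + ‖ctControl U x‖ := norm_le_norm_sub_add _ _
      rw [norm_sub_rev, hkU x hx] at h3
      rw [hkU x hx] at h1
      have h4 : (Lk : ℝ) * ‖x‖ ≤ Lk * M := by gcongr
      have := hkn x
      rw [hMu]
      linarith
    rw [if_pos hx, hGf y _ hy h2]

/-- Truncation of the sampled-data system outside a ball: `S T x y` is a sampling step of the
truncated system, `h` its continuous-time closed loop. -/
theorem exists_truncation (hf : PlantAssumption f) (huc : CTControlAssumption (ctControl U))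
    (hStC : StC (fun x _ => ctControl U x) U) {M : ℝ} (hM : 0 ≤ M) :
    ∃ (h : E n → E n) (L : ℝ≥0) (S : ℝ → E n → E n → Prop), 0 < L ∧ LipschitzWith L h ∧
      (∀ y, ‖y‖ ≤ M → h y = f y (ctControl U y)) ∧
      (∃ Ts : ℝ, 0 < Ts ∧ ∀ T, 0 < T → T < Ts → ∀ x, (∃ y, S T x y) ∧
        (‖x‖ ≤ M / 2 → ∀ y, S T x y → y ∈ closedLoop (exactModel f) U x T)) ∧
      ∀ η : ℝ, 0 < η → ∃ Ts : ℝ, 0 < Ts ∧ ∀ T ∈ Phi Ts, ∀ (x : ℕ → E n) (z : ℝ → E n),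
        (∀ k, S (T k) (x k) (x (k + 1))) → IsCTSolution h (x 0) z → ∀ k,
          ‖x k - z (∑ i ∈ Finset.range k, T i)‖ ≤
            η * Real.exp (2 * L * ∑ i ∈ Finset.range k, T i) * ‖x 0‖ := by
  obtain ⟨h, g, L, H, hh, hg⟩ := exists_isFrozenField hf huc hStC hM
  have hL0 : 0 < L := zero_lt_one.trans_le H.one_le
  refine ⟨h, L, StepTo g, hL0, H.lipschitz, hh, ?_, ?_⟩
  · obtain ⟨Ts, hTs, h1⟩ := exists_Phi_of_eventually (hg.and (H.eventually_small one_pos))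
    refine ⟨Ts, hTs, fun T hT0 hT x => ?_⟩
    obtain ⟨hgf, -, hLT, hnear⟩ := h1 T hT0 hT
    constructor
    · obtain ⟨φ, hφ⟩ := exists_isSolOn (H.lipschitz_frozen x T) hL0 x hT0.le (by linarith)
      exact ⟨φ T, φ, hφ, rfl⟩
    · rintro hx y ⟨φ, hφ, rfl⟩
      refine (mem_exactModel_iff (hf.continuous _) hT0.le).2 ⟨φ, hφ.congr_field ?_, rfl⟩
      intro t ht
      -- From `‖x‖ ≤ M / 2` the trajectory moves by at most `‖x‖ / 2` between samples, so it never
      -- leaves the region where the truncation is exact.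
      have h2 := H.norm_sub_le_of_isSolOn (by norm_num) (by linarith) hnear hφ ht
      have h3 : ‖φ t‖ ≤ ‖φ t - x‖ + ‖x‖ := norm_le_norm_sub_add _ _
      have h4 : 4 * L * T * ‖x‖ ≤ 1 / 2 * ‖x‖ := by gcongr
      have h5 := norm_nonneg x
      exact hgf x (φ t) (by linarith) (by linarith)
  · intro η hη
    obtain ⟨Ts, hTs, h1⟩ := exists_Phi_of_eventually (H.eventually_small (lt_min hη one_pos))
    refine ⟨Ts, hTs, fun T hT x z hx hz k => ?_⟩
    refine (H.norm_sub_solution_le (min_le_right η 1) (fun k => h1 _ (hT k).1 (hT k).2)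
      hx hz k).trans ?_
    have h2 := Real.exp_pos (L * ∑ i ∈ Finset.range k, T i)
    have h3 : 0 < min η 1 := lt_min hη one_pos
    calc min η 1 * (Real.exp (2 * L * ∑ i ∈ Finset.range k, T i) -
          Real.exp (L * ∑ i ∈ Finset.range k, T i)) * ‖x 0‖
        ≤ min η 1 * Real.exp (2 * L * ∑ i ∈ Finset.range k, T i) * ‖x 0‖ := by
          gcongr; linarith
      _ ≤ _ := by gcongr; exact min_le_left _ _

end Plant

/-! ### Comparison functions, sampling instants and step sequences -/

section ComparisonFunctions

theorem IsClassKL.nonneg {β : ℝ → ℝ → ℝ} (hβ : IsClassKL β) {s t : ℝ} (hs : 0 ≤ s) (ht : 0 ≤ t) :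
    0 ≤ β s t := by
  have h := hβ.1 t ht
  have h0 : β 0 t = 0 := h.2.2
  exact h0.symm.le.trans (h.2.1.monotoneOn self_mem_Ici hs hs)

theorem IsClassKL.mono {β : ℝ → ℝ → ℝ} (hβ : IsClassKL β) {s s' t t' : ℝ} (hs : 0 ≤ s)
    (hs' : 0 < s') (hss : s ≤ s') (ht' : 0 ≤ t') (htt : t' ≤ t) : β s t ≤ β s' t' :=
  ((hβ.1 t (ht'.trans htt)).2.1.monotoneOn hs hs'.le hss).trans
    ((hβ.2.1 s' hs').antitoneOn ht' (ht'.trans htt) htt)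

end ComparisonFunctions

theorem Phi_mono {a b : ℝ} (h : a ≤ b) : Phi a ⊆ Phi b := fun _ hT i =>
  ⟨(hT i).1, (hT i).2.trans_le h⟩

theorem sum_nonneg_of_mem_Phi {Ts : ℝ} {T : ℕ → ℝ} (hT : T ∈ Phi Ts) (k : ℕ) :
    0 ≤ ∑ i ∈ Finset.range k, T i := Finset.sum_nonneg fun i _ => (hT i).1.le

/-- The instant before the first passage lies below `τ`, so the overshoot is less than one period.
-/
theorem exists_first_passage {Ts τ : ℝ} (hτ : 0 < τ) {T : ℕ → ℝ} (hT : T ∈ Phi Ts) {k : ℕ}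
    (hk : τ ≤ ∑ i ∈ Finset.range k, T i) :
    ∃ j, 0 < j ∧ j ≤ k ∧ τ ≤ ∑ i ∈ Finset.range j, T i ∧ ∑ i ∈ Finset.range j, T i ≤ τ + Ts ∧
      ∀ i < j, ∑ l ∈ Finset.range i, T l < τ := by
  classical
  have hex : ∃ k, τ ≤ ∑ i ∈ Finset.range k, T i := ⟨k, hk⟩
  have hlt : ∀ i < Nat.find hex, ∑ l ∈ Finset.range i, T l < τ := fun i hi =>
    not_le.1 (Nat.find_min hex hi)
  have hpos : 0 < Nat.find hex := by
    rw [Nat.find_pos]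
    simpa using hτ
  refine ⟨Nat.find hex, hpos, Nat.find_min' hex hk, Nat.find_spec hex, ?_, hlt⟩
  obtain ⟨i, hi⟩ := Nat.exists_eq_succ_of_ne_zero hpos.ne'
  have h1 := hlt i (by omega)
  rw [hi, Finset.sum_range_succ]
  linarith [(hT i).2]

theorem exists_step_sequence {X : Type*} {r : ℕ → X → X → Prop} (hr : ∀ k x, ∃ y, r k x y)
    (x₀ : X) : ∃ x : ℕ → X, x 0 = x₀ ∧ ∀ k, r k (x k) (x (k + 1)) := by
  choose F hF using hr
  exact ⟨fun k => Nat.rec x₀ F k, rfl, fun k => hF k _⟩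

/-! ### Transfer of stability between (1) and its sampled version -/

section Plant

variable {n m : ℕ} {f : E n → E m → E n} {U : E n → ℝ → E m}

theorem closedLoop_lipschitzOnBalls (hf : PlantAssumption f)
    (huc : CTControlAssumption (ctControl U)) (hStC : StC (fun x _ => ctControl U x) U) :
    LipschitzOnBalls fun x => f x (ctControl U x) := fun M => by
  obtain ⟨h, g, L, H, hh, -⟩ := exists_isFrozenField hf huc hStC (le_max_right M 0)
  refine ⟨L, fun x hx y hy => ?_⟩
  simp only [← hh x (le_max_of_le_left (by simpa using hx)),
    ← hh y (le_max_of_le_left (by simpa using hy))]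
  exact H.lipschitz x y

theorem IsDTSolution.eq (hf : PlantAssumption f) {Ts : ℝ} {T : ℕ → ℝ} (hT : T ∈ Phi Ts)
    {x₀ : E n} {x y : ℕ → E n} (hx : IsDTSolution (closedLoop (exactModel f) U) T x₀ x)
    (hy : IsDTSolution (closedLoop (exactModel f) U) T x₀ y) : x = y := by
  funext k
  induction k with
  | zero => rw [hx.1, hy.1]
  | succ k ih =>
    have := hx.2 k
    rw [ih] at this
    exact closedLoop_subsingleton hf (hT k).1.le this (hy.2 k)

/-- The exact model is single-valued, so exhibiting one bounded solution proves both existence and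
the bound for all solutions. -/
theorem DTBound.of_exists (hf : PlantAssumption f) {b : ℝ → ℝ → ℝ} {M Ts : ℝ}
    (h : ∀ T ∈ Phi Ts, ∀ x₀ : E n, ‖x₀‖ ≤ M → ∃ x : ℕ → E n,
      IsDTSolution (closedLoop (exactModel f) U) T x₀ x ∧
      ∀ k, ‖x k‖ ≤ b ‖x₀‖ (∑ i ∈ Finset.range k, T i)) :
    DTBound (closedLoop (exactModel f) U) b M Ts := fun T hT x₀ hx₀ => by
  obtain ⟨x, hx, hb⟩ := h T hT x₀ hx₀
  exact ⟨⟨x, hx⟩, fun y hy => hx.eq hf hT hy ▸ hb⟩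

/-- Uniform exponential estimates pass from the continuous-time closed loop to its sampled version,
with constants that do not depend on the ball. -/
theorem DTBound.of_exponential (hf : PlantAssumption f) (huc : CTControlAssumption (ctControl U))
    (hStC : StC (fun x _ => ctControl U x) U) {K lam : ℝ} (hK : 1 ≤ K) (hlam : 0 < lam) :
    ∃ K' lam' : ℝ, 1 ≤ K' ∧ 0 < lam' ∧ ∀ R : ℝ, 0 ≤ R →
      (∀ x₀ : E n, ‖x₀‖ ≤ R → CTBoundFrom (fun x => f x (ctControl U x))
        (fun r t => K * r * Real.exp (-lam * t)) x₀) →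
      ∃ Ts : ℝ, 0 < Ts ∧ DTBound (closedLoop (exactModel f) U)
        (fun r t => K' * r * Real.exp (-lam' * t)) R Ts := by
  obtain ⟨τ, hτ, hKτ⟩ : ∃ τ : ℝ, 0 < τ ∧ K * Real.exp (-lam * τ) ≤ 1 / 4 := by
    refine ⟨Real.log (4 * K) / lam, div_pos (Real.log_pos (by linarith)) hlam, ?_⟩
    have : -lam * (Real.log (4 * K) / lam) = -Real.log (4 * K) := by field_simp
    rw [this, Real.exp_neg, Real.exp_log (by positivity)]
    apply le_of_eq; field_simp
  -- The rate that halves over `τ + 1`, the latest possible first passage of `τ` with periods below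
  -- `1`.
  set mu := Real.log 2 / (τ + 1) with hmu
  have hmu0 : 0 < mu := div_pos (Real.log_pos (by norm_num)) (by linarith)
  have hmuτ : Real.exp (-mu * (τ + 1)) = 1 / 2 := by
    have : -mu * (τ + 1) = -Real.log 2 := by rw [hmu]; field_simp
    rw [this, Real.exp_neg, Real.exp_log (by norm_num)]; norm_num
  have hmut : ∀ t, t ≤ τ + 1 → 1 / 2 ≤ Real.exp (-mu * t) := fun t ht => by
    rw [← hmuτ]
    exact Real.exp_le_exp.2 (by nlinarith)
  refine ⟨2 * (K + 1), mu, by linarith, hmu0, fun R hR hCT => ?_⟩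
  obtain ⟨h, L, S, hL, -, hh, ⟨T₁, hT₁, hS⟩, happ⟩ :=
    -- Twice the bound `2 * (K + 1) * R` to be proved for the samples, which must lie in the half
    -- ball.
    exists_truncation hf huc hStC (M := 4 * (K + 1) * R) (by positivity)
  -- The exponential factor cancels the error growth up to time `τ + 1`, leaving a relative error of
  -- `1 / 4`.
  obtain ⟨T₂, hT₂, happ⟩ := happ (1 / 4 * Real.exp (-(2 * L * (τ + 1)))) (by positivity)
  have window : ∀ T ∈ Phi T₂, ∀ x : ℕ → E n, ‖x 0‖ ≤ R → (∀ k, S (T k) (x k) (x (k + 1))) →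
      ∀ k, ∑ i ∈ Finset.range k, T i ≤ τ + 1 →
        ‖x k‖ ≤ (K * Real.exp (-lam * ∑ i ∈ Finset.range k, T i) + 1 / 4) * ‖x 0‖ := by
    intro T hT x hx hxS k hk
    have ht0 := sum_nonneg_of_mem_Phi hT k
    obtain ⟨⟨z, hz⟩, hzb⟩ := hCT (x 0) hx
    have hz' : IsCTSolution h (x 0) z := hz.congr_field fun t ht => (hh _ (by
      refine (hzb z hz t ht).trans ?_
      have : Real.exp (-lam * t) ≤ 1 := Real.exp_le_one_iff.2 (by nlinarith)
      calc K * ‖x 0‖ * Real.exp (-lam * t) ≤ K * R * 1 := by gcongr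
        _ ≤ 4 * (K + 1) * R := by nlinarith)).symm
    have h1 := happ T hT x z hxS hz' k
    have h2 := hzb z hz _ ht0
    have h3 := norm_le_norm_sub_add (x k) (z (∑ i ∈ Finset.range k, T i))
    have h4 : Real.exp (-(2 * L * (τ + 1))) *
        Real.exp (2 * L * ∑ i ∈ Finset.range k, T i) ≤ 1 := by
      rw [← Real.exp_add]
      refine Real.exp_le_one_iff.2 ?_
      have : 2 * L * ∑ i ∈ Finset.range k, T i ≤ 2 * L * (τ + 1) := by gcongr
      linarith
    have h5 := mul_le_mul_of_nonneg_right h4 (norm_nonneg (x 0))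
    linarith
  -- Quantified over all sequences so that the induction can restart at the first passage `j`, where
  -- `1 / 4 + 1 / 4` gives `‖x j‖ ≤ ‖x 0‖ / 2`.
  have decay : ∀ k, ∀ T ∈ Phi (min T₂ 1), ∀ x : ℕ → E n, ‖x 0‖ ≤ R →
      (∀ k, S (T k) (x k) (x (k + 1))) →
      ‖x k‖ ≤ 2 * (K + 1) * ‖x 0‖ * Real.exp (-mu * ∑ i ∈ Finset.range k, T i) := by
    intro k
    induction k using Nat.strong_induction_on with
    | _ k ih =>
      intro T hT x hx hxS
      have hwin := window T (Phi_mono (min_le_left _ _) hT) x hx hxS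
      have hn := norm_nonneg (x 0)
      rcases le_total (∑ i ∈ Finset.range k, T i) (τ + 1) with hk | hk
      · have h1 := hwin k hk
        have h2 := hmut _ hk
        have h3 : Real.exp (-lam * ∑ i ∈ Finset.range k, T i) ≤ 1 :=
          Real.exp_le_one_iff.2 (by nlinarith [sum_nonneg_of_mem_Phi hT k])
        calc ‖x k‖ ≤ (K * 1 + 1 / 4) * ‖x 0‖ := h1.trans (by gcongr)
          _ ≤ 2 * (K + 1) * ‖x 0‖ * (1 / 2) := by nlinarith
          _ ≤ _ := by gcongr
      · obtain ⟨j, hj0, hjk, hτj, hjτ, -⟩ := exists_first_passage hτ hT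
          (k := k) (by linarith)
        have hj1 : ∑ i ∈ Finset.range j, T i ≤ τ + 1 :=
          hjτ.trans (by gcongr; exact min_le_right _ _)
        have hhalf : ‖x j‖ ≤ 1 / 2 * ‖x 0‖ := by
          refine (hwin j hj1).trans ?_
          have : K * Real.exp (-lam * ∑ i ∈ Finset.range j, T i) ≤
              K * Real.exp (-lam * τ) := by
            gcongr ?_ * ?_
            exact Real.exp_le_exp.2 (by nlinarith)
          gcongr
          linarith
        have h1 := ih (k - j) (by omega) (fun i => T (j + i)) (fun i => hT _)
          (fun i => x (j + i)) (by simp only [add_zero]; linarith) (fun i => hxS _)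
        simp only [add_zero, Nat.add_sub_cancel' hjk] at h1
        have h2 := Finset.sum_range_add T j (k - j)
        rw [Nat.add_sub_cancel' hjk] at h2
        have h3 := hmut _ hj1
        rw [h2, mul_add (-mu), Real.exp_add]
        calc ‖x k‖ ≤ _ := h1
          _ ≤ 2 * (K + 1) * (Real.exp (-mu * ∑ i ∈ Finset.range j, T i) * ‖x 0‖) *
              Real.exp (-mu * ∑ i ∈ Finset.range (k - j), T (j + i)) := by
            gcongr
            exact hhalf.trans (by gcongr)
          _ = _ := by ring
  refine ⟨min T₁ (min T₂ 1), by positivity, DTBound.of_exists hf fun T hT x₀ hx₀ => ?_⟩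
  have hT₁' := Phi_mono (min_le_left _ _) hT
  -- Truncated steps always exist. Their bound keeps the samples in the half ball, where they are
  -- steps of the exact model, so the latter's solution never escapes.
  obtain ⟨x, rfl, hx⟩ := exists_step_sequence (r := fun k => S (T k))
    (fun k x => (hS _ (hT₁' k).1 (hT₁' k).2 x).1) x₀
  have hb := fun k => decay k T (Phi_mono (min_le_right _ _) hT) x hx₀ hx
  refine ⟨x, ⟨rfl, fun k => (hS _ (hT₁' k).1 (hT₁' k).2 (x k)).2 ?_ _ (hx k)⟩, hb⟩
  refine (hb k).trans ?_
  have : Real.exp (-mu * ∑ i ∈ Finset.range k, T i) ≤ 1 :=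
    Real.exp_le_one_iff.2 (by nlinarith [sum_nonneg_of_mem_Phi hT k])
  calc 2 * (K + 1) * ‖x 0‖ * Real.exp (-mu * ∑ i ∈ Finset.range k, T i)
      ≤ 2 * (K + 1) * R * 1 := by gcongr
    _ = _ := by ring

theorem IsDTSolution.append {F : E n → ℝ → Set (E n)} {T : ℕ → ℝ} {j : ℕ} {x y : ℕ → E n}
    (hx : ∀ k < j, x (k + 1) ∈ F (x k) (T k))
    (hy : IsDTSolution F (fun i => T (j + i)) (x j) y) :
    IsDTSolution F T (x 0) (fun k => if k < j then x k else y (k - j)) := by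
  constructor
  · rcases Nat.eq_zero_or_pos j with rfl | h
    · simpa using hy.1
    · simp [h]
  · intro k
    rcases lt_trichotomy (k + 1) j with h | h | h
    · simpa [h, (Nat.lt_succ_self k).trans h] using hx k (by omega)
    · subst h
      simpa [hy.1] using hx k (by omega)
    · have h1 : ¬ k < j := by omega
      have h2 : ¬ k + 1 < j := by omega
      have := hy.2 (k - j)
      simp only [Nat.add_sub_cancel' (not_lt.1 h1)] at this
      simpa [h1, h2, Nat.sub_add_comm (not_lt.1 h1)] using this

/-- Global asymptotic stability passes to the sampled version, practically and semiglobally, with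
the same comparison function, when the sampled version is locally exponentially stable. -/
theorem SPSVSR.of_GAS (hf : PlantAssumption f) (huc : CTControlAssumption (ctControl U))
    (hStC : StC (fun x _ => ctControl U x) U) (hGAS : GAS fun x => f x (ctControl U x))
    (hLES : LESVSR (closedLoop (exactModel f) U)) : SPSVSR (closedLoop (exactModel f) U) := by
  obtain ⟨β, hβ, hCT⟩ := hGAS
  obtain ⟨K, R₀, T₀, lam, hK, hR₀, hT₀, hlam, hloc⟩ := hLES
  refine ⟨β, hβ, fun M R hM hR => ?_⟩
  -- A radius inside the region of local exponential stability from which later samples stay within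
  -- the allowance `R`.
  obtain ⟨r, hr, hrR₀, hKr⟩ : ∃ r : ℝ, 0 < r ∧ r ≤ R₀ ∧ K * r ≤ R := by
    refine ⟨min R₀ (R / K), by positivity, min_le_left _ _, ?_⟩
    calc K * min R₀ (R / K) ≤ K * (R / K) := by gcongr; exact min_le_right _ _
      _ = R := by field_simp
  -- `M + 1` replaces `M` because monotonicity of `β` in time needs a positive first argument.
  obtain ⟨τ, hτ, hβτ⟩ : ∃ τ : ℝ, 0 < τ ∧ β (M + 1) τ ≤ r / 2 :=
    ((eventually_gt_atTop 0).and ((hβ.2.2 (M + 1) (by positivity)).eventually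
      (ge_mem_nhds (half_pos hr)))).exists
  have hβM : ∀ {s t : ℝ}, 0 ≤ s → s ≤ M → 0 ≤ t → β s t ≤ β (M + 1) 0 := fun hs hsM ht =>
    hβ.mono hs (by positivity) (by linarith) le_rfl ht
  have hβ0 : 0 ≤ β (M + 1) 0 := hβ.nonneg (by positivity) le_rfl
  set ε := min R (r / 2) with hε
  have hε0 : 0 < ε := by positivity
  obtain ⟨h, L, S, hL, -, hh, ⟨T₁, hT₁, hS⟩, happ⟩ :=
    exists_truncation hf huc hStC (M := 2 * (β (M + 1) 0 + R)) (by positivity)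
  obtain ⟨T₂, hT₂, happ⟩ :=
    happ (ε / (M + 1) * Real.exp (-(2 * L * (τ + 1)))) (by positivity)
  refine ⟨min T₀ (min T₁ (min T₂ 1)), by positivity, DTBound.of_exists hf fun T hT x₀ hx₀ => ?_⟩
  have hT₀' : T ∈ Phi T₀ := Phi_mono (min_le_left _ _) hT
  have hT₁' : T ∈ Phi T₁ := Phi_mono ((min_le_right _ _).trans (min_le_left _ _)) hT
  have hT₂' : T ∈ Phi T₂ :=
    Phi_mono ((min_le_right _ _).trans ((min_le_right _ _).trans (min_le_left _ _))) hT
  have hT₃' : T ∈ Phi 1 :=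
    Phi_mono ((min_le_right _ _).trans ((min_le_right _ _).trans (min_le_right _ _))) hT
  obtain ⟨x, rfl, hx⟩ := exists_step_sequence (r := fun k => S (T k))
    (fun k x => (hS _ (hT₁' k).1 (hT₁' k).2 x).1) x₀
  have hn := norm_nonneg (x 0)
  have window : ∀ k, ∑ i ∈ Finset.range k, T i ≤ τ + 1 →
      ‖x k‖ ≤ β ‖x 0‖ (∑ i ∈ Finset.range k, T i) + ε := by
    intro k hk
    have ht0 := sum_nonneg_of_mem_Phi hT k
    obtain ⟨⟨z, hz⟩, hzb⟩ := hCT (x 0)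
    have hz' : IsCTSolution h (x 0) z := hz.congr_field fun t ht => (hh _ (by
      refine (hzb z hz t ht).trans ((hβM hn hx₀ ht).trans ?_)
      linarith)).symm
    have h1 := happ T hT₂' x z hx hz' k
    have h2 := hzb z hz _ ht0
    have h3 := norm_le_norm_sub_add (x k) (z (∑ i ∈ Finset.range k, T i))
    have h4 : Real.exp (-(2 * L * (τ + 1))) *
        Real.exp (2 * L * ∑ i ∈ Finset.range k, T i) ≤ 1 := by
      rw [← Real.exp_add]
      refine Real.exp_le_one_iff.2 ?_
      have : 2 * L * ∑ i ∈ Finset.range k, T i ≤ 2 * L * (τ + 1) := by gcongr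
      linarith
    have h5 : ε / (M + 1) * Real.exp (-(2 * L * (τ + 1))) *
        Real.exp (2 * L * ∑ i ∈ Finset.range k, T i) * ‖x 0‖ ≤ ε := by
      calc _ = ε / (M + 1) * (Real.exp (-(2 * L * (τ + 1))) *
          Real.exp (2 * L * ∑ i ∈ Finset.range k, T i)) * ‖x 0‖ := by ring
        _ ≤ ε / (M + 1) * 1 * (M + 1) := by gcongr; linarith
        _ = ε := by field_simp
    linarith
  have hεR : ε ≤ R := min_le_left _ _
  have step : ∀ k, ∑ i ∈ Finset.range k, T i ≤ τ + 1 →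
      x (k + 1) ∈ closedLoop (exactModel f) U (x k) (T k) := fun k hk => by
    refine (hS _ (hT₁' k).1 (hT₁' k).2 (x k)).2 ?_ _ (hx k)
    have h1 := window k hk
    have h2 := hβM hn hx₀ (sum_nonneg_of_mem_Phi hT k)
    linarith
  -- The periods may be summable; if the instants never reach `τ`, the window estimate covers every
  -- `k`.
  by_cases hpass : ∃ k, τ ≤ ∑ i ∈ Finset.range k, T i
  · obtain ⟨k, hk⟩ := hpass
    obtain ⟨j, -, -, hτj, hjτ, hlt⟩ := exists_first_passage hτ hT₃' hk
    have hxj : ‖x j‖ ≤ r := by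
      have h1 := window j hjτ
      have h2 := hβ.mono hn (by positivity : 0 < M + 1) (by linarith) hτ.le hτj
      have h3 : ε ≤ r / 2 := min_le_right _ _
      linarith
    obtain ⟨⟨y, hy⟩, hyb⟩ := hloc (fun i => T (j + i)) (fun i => hT₀' _) (x j) (hxj.trans hrR₀)
    refine ⟨_, IsDTSolution.append (fun k hk => step k (by linarith [hlt k hk])) hy, fun k => ?_⟩
    by_cases hkj : k < j
    · simp only [hkj, if_true]
      have := window k (by linarith [hlt k hkj])
      linarith
    · simp only [hkj, if_false]
      have h1 := hyb y hy (k - j)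
      have h2 := hβ.nonneg hn (sum_nonneg_of_mem_Phi hT k)
      have h3 : Real.exp (-lam * ∑ i ∈ Finset.range (k - j), T (j + i)) ≤ 1 :=
        Real.exp_le_one_iff.2 (by
          nlinarith [sum_nonneg_of_mem_Phi (T := fun i => T (j + i)) (fun i => hT _) (k - j)])
      have h4 : K * ‖x j‖ * Real.exp (-lam * ∑ i ∈ Finset.range (k - j), T (j + i)) ≤
          K * r * 1 := by gcongr
      linarith
  · push Not at hpass
    refine ⟨x, ⟨rfl, fun k => step k (by linarith [hpass k])⟩, fun k => ?_⟩
    have := window k (by linarith [hpass k])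
    linarith

/-- Practical bounds on the sampled solutions carry over to the continuous-time solution as the
sampling period tends to zero. -/
theorem CTBoundFrom.of_DTBound (hf : PlantAssumption f) (huc : CTControlAssumption (ctControl U))
    (hStC : StC (fun x _ => ctControl U x) U) {b : ℝ → ℝ → ℝ} {x₀ : E n} {B : ℝ}
    (hB : ∀ t, 0 ≤ t → b ‖x₀‖ t ≤ B)
    (hDT : ∀ R : ℝ, 0 < R → ∃ Ts : ℝ, 0 < Ts ∧
      DTBound (closedLoop (exactModel f) U) (fun r t => b r t + R) ‖x₀‖ Ts) :
    CTBoundFrom (fun x => f x (ctControl U x)) b x₀ := by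
  obtain ⟨h, L, S, hL, hlip, hh, ⟨T₁, hT₁, hS⟩, happ⟩ :=
    exists_truncation hf huc hStC (M := 2 * (|B| + 1)) (by positivity)
  -- Global existence comes from the truncated field; the bound `key` then shows that `z` solves (1)
  -- itself.
  obtain ⟨z, hz⟩ := exists_global_solution hlip hL x₀
  replace hz : IsCTSolution h x₀ z := hz
  have hB' := le_abs_self B
  have key : ∀ t, 0 ≤ t → ‖z t‖ ≤ b ‖x₀‖ t := by
    intro t ht
    refine le_of_forall_pos_le_add fun ε hε => ?_
    obtain ⟨R, hR, hR1, hRε⟩ : ∃ R : ℝ, 0 < R ∧ R ≤ 1 ∧ R ≤ ε / 2 :=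
      ⟨min 1 (ε / 2), by positivity, min_le_left _ _, min_le_right _ _⟩
    obtain ⟨T₂, hT₂, hDT⟩ := hDT R hR
    obtain ⟨T₃, hT₃, happ⟩ :=
      happ (ε / 2 / (‖x₀‖ + 1) * Real.exp (-(2 * L * t))) (by positivity)
    obtain ⟨T, N, hT, hTN⟩ : ∃ (T : ℝ) (N : ℕ), T ∈ Ioo 0 (min T₁ (min T₂ T₃)) ∧ N * T = t := by
      have hm : 0 < min T₁ (min T₂ T₃) := by positivity
      rcases ht.eq_or_lt with rfl | ht
      · exact ⟨min T₁ (min T₂ T₃) / 2, 0, ⟨by positivity, by linarith⟩, by simp⟩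
      · obtain ⟨N, hN⟩ := exists_nat_gt (t / min T₁ (min T₂ T₃))
        have hN0 : (0 : ℝ) < N := lt_trans (by positivity) hN
        refine ⟨t / N, N, ⟨by positivity, ?_⟩, by field_simp⟩
        rw [div_lt_iff₀ hm] at hN
        rw [div_lt_iff₀ hN0]
        linarith
    have hTm : (fun _ : ℕ => T) ∈ Phi (min T₁ (min T₂ T₃)) := fun _ => hT
    have hTm₁ := Phi_mono (min_le_left _ _) hTm
    have hTm₂ := Phi_mono ((min_le_right _ _).trans (min_le_left _ _)) hTm
    have hTm₃ := Phi_mono ((min_le_right _ _).trans (min_le_right _ _)) hTm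
    obtain ⟨⟨x, hx⟩, hxb⟩ := hDT _ hTm₂ x₀ le_rfl
    replace hxb := hxb x hx
    -- The assumed bound keeps the samples in the half ball, so a truncated step is an exact one,
    -- and uniqueness identifies it with `x (k + 1)`.
    have hxS : ∀ k, S T (x k) (x (k + 1)) := fun k => by
      obtain ⟨⟨y, hy⟩, hmem⟩ := hS T hT.1 (hTm₁ 0).2 (x k)
      have h1 := hxb k
      have h2 := hB _ (sum_nonneg_of_mem_Phi hTm k)
      have h3 := hmem (by linarith) y hy
      rwa [closedLoop_subsingleton hf hT.1.le (hx.2 k) h3]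
    have h1 := happ _ hTm₃ x z hxS (by rwa [hx.1]) N
    have h2 := hxb N
    simp only [Finset.sum_const, Finset.card_range, nsmul_eq_mul, hTN, hx.1] at h1 h2
    have h3 := norm_le_norm_sub_add (z t) (x N)
    rw [norm_sub_rev] at h3
    have h4 : ε / 2 / (‖x₀‖ + 1) * Real.exp (-(2 * L * t)) * Real.exp (2 * L * t) * ‖x₀‖ ≤
        ε / 2 := by
      rw [mul_assoc (ε / 2 / (‖x₀‖ + 1)), ← Real.exp_add, neg_add_cancel, Real.exp_zero, mul_one,
        div_mul_eq_mul_div, div_le_iff₀ (by positivity)]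
      gcongr
      linarith
    linarith
  refine CTBoundFrom.of_solution (closedLoop_lipschitzOnBalls hf huc hStC)
    (hz.congr_field fun t ht => hh _ ?_) key
  linarith [key t ht, hB t ht, abs_nonneg B]

theorem CTBoundFrom.of_DTBound_exponential (hf : PlantAssumption f)
    (huc : CTControlAssumption (ctControl U)) (hStC : StC (fun x _ => ctControl U x) U)
    {K lam M Ts : ℝ} (hK : 1 ≤ K) (hlam : 0 < lam) (hTs : 0 < Ts)
    (hDT : DTBound (closedLoop (exactModel f) U)
      (fun r t => K * r * Real.exp (-lam * t)) M Ts) {x₀ : E n} (hx₀ : ‖x₀‖ ≤ M) :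
    CTBoundFrom (fun x => f x (ctControl U x)) (fun r t => K * r * Real.exp (-lam * t)) x₀ := by
  refine CTBoundFrom.of_DTBound hf huc hStC (B := K * ‖x₀‖) (fun t ht => ?_)
    fun R hR => ⟨Ts, hTs, fun T hT y hy => ?_⟩
  · exact mul_le_of_le_one_right (by positivity) (Real.exp_le_one_iff.2 (by nlinarith))
  · obtain ⟨h1, h2⟩ := hDT T hT y (hy.trans hx₀)
    exact ⟨h1, fun x hx k => (h2 x hx k).trans (by linarith)⟩

theorem LES_iff_LESVSR (hf : PlantAssumption f) (huc : CTControlAssumption (ctControl U))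
    (hStC : StC (fun x _ => ctControl U x) U) :
    LES (fun x => f x (ctControl U x)) ↔ LESVSR (closedLoop (exactModel f) U) := by
  constructor
  · rintro ⟨K, R, lam, hK, hR, hlam, h⟩
    obtain ⟨K', lam', hK', hlam', h'⟩ := DTBound.of_exponential hf huc hStC hK hlam
    obtain ⟨Ts, hTs, h''⟩ := h' R hR.le h
    exact ⟨K', R, Ts, lam', hK', hR, hTs, hlam', h''⟩
  · rintro ⟨K, R, Ts, lam, hK, hR, hTs, hlam, h⟩
    exact ⟨K, R, lam, hK, hR, hlam, fun x₀ hx₀ =>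
      CTBoundFrom.of_DTBound_exponential hf huc hStC hK hlam hTs h hx₀⟩

theorem GES_iff_SESVSR (hf : PlantAssumption f) (huc : CTControlAssumption (ctControl U))
    (hStC : StC (fun x _ => ctControl U x) U) :
    GES (fun x => f x (ctControl U x)) ↔ SESVSR (closedLoop (exactModel f) U) := by
  constructor
  · rintro ⟨K, lam, hK, hlam, h⟩
    obtain ⟨K', lam', hK', hlam', h'⟩ := DTBound.of_exponential hf huc hStC hK hlam
    exact ⟨K', lam', hK', hlam', fun M hM => h' M hM fun x₀ _ => h x₀⟩
  · rintro ⟨K, lam, hK, hlam, h⟩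
    refine ⟨K, lam, hK, hlam, fun x₀ => ?_⟩
    obtain ⟨Ts, hTs, h'⟩ := h ‖x₀‖ (norm_nonneg _)
    exact CTBoundFrom.of_DTBound_exponential hf huc hStC hK hlam hTs h' le_rfl

theorem GAS.of_SPSVSR (hf : PlantAssumption f) (huc : CTControlAssumption (ctControl U))
    (hStC : StC (fun x _ => ctControl U x) U) (h : SPSVSR (closedLoop (exactModel f) U)) :
    GAS fun x => f x (ctControl U x) := by
  obtain ⟨β, hβ, h⟩ := h
  -- The shift by `1` covers `x₀ = 0`.
  exact ⟨β, hβ, fun x₀ => CTBoundFrom.of_DTBound hf huc hStC (B := β (‖x₀‖ + 1) 0)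
    (fun t ht => hβ.mono (norm_nonneg _) (by positivity) (by linarith) le_rfl ht)
    fun R hR => h ‖x₀‖ R (norm_nonneg _) hR⟩

end Plant

end SampledData

theorem theorem3 {n m : ℕ} (f : SampledData.E n → SampledData.E m → SampledData.E n)
    (U : SampledData.E n → ℝ → SampledData.E m)
    (hf : SampledData.PlantAssumption f)
    (huc : SampledData.CTControlAssumption (SampledData.ctControl U))
    (hStL : SampledData.StL U)
    (hStC : SampledData.StC (fun x _ => SampledData.ctControl U x) U) :
    (SampledData.LES (fun x => f x (SampledData.ctControl U x)) ↔
      SampledData.LESVSR (SampledData.closedLoop (SampledData.exactModel f) U)) ∧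
    (SampledData.GALES (fun x => f x (SampledData.ctControl U x)) ↔
      SampledData.SLESVSR (SampledData.closedLoop (SampledData.exactModel f) U)) ∧
    (SampledData.GES (fun x => f x (SampledData.ctControl U x)) ↔
      SampledData.SESVSR (SampledData.closedLoop (SampledData.exactModel f) U)) := by
  have hLES := SampledData.LES_iff_LESVSR hf huc hStC
  refine ⟨hLES, ⟨fun h => ?_, fun h => ?_⟩, SampledData.GES_iff_SESVSR hf huc hStC⟩
  · exact ⟨SampledData.SPSVSR.of_GAS hf huc hStC h.1 (hLES.1 h.2), hLES.1 h.2⟩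
  · exact ⟨SampledData.GAS.of_SPSVSR hf huc hStC h.1, hLES.2 h.2⟩
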